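/- **Setting.** $n$ servers each store the same $\mathsf M$ files $\boldsymbol X^{(1)},\dots,\boldsymbol X^{(\mathsf M)}\in\mathcal X^\beta$, whose symbols are i.i.d. uniform on a finite alphabet $\mathcal X$ with $|\mathcal X|\ge 2$, where $\beta\ge 1$. The requested index $M$ is uniform on $\{1,\dots,\mathsf M\}$. An $(\mathsf M,n)$ IR scheme consists of a random strategy $\boldsymbol S$ (with $M$, $\boldsymbol S$ and the files independent), queries $\boldsymbol Q_l=\phi_l(M,\boldsymbol S)\in\mathcal Q_l$ to the servers $l=1,\dots,n$, and answers $\boldsymbol A_l=\varphi_l(\boldsymbol Q_l,\boldsymbol X^{(1)},\dots,\boldsymbol X^{(\mathsf M)})\in\mathcal A^{\ell_l(\boldsymbol Q_l)}$ with length functions $\ell_l$, such that $H(\boldsymbol X^{(M)}\mid \boldsymbol A_1,\dots,\boldsymbol A_n,\boldsymbol Q_1,\dots,\boldsymbol Q_n,M)=0$. Its rate is $$\mathsf R=\frac{\beta\log_2|\mathcal X|}{\log_2|\mathcal A|\,\sum_{l}\mathbb E[\ell_l(\boldsymbol Q_l)]},$$ and its MI leakage is $\rho^{(\mathsf{MI})}=\frac1n\sum_{l}I(M;\boldsymbol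 Q_l)$ (in bits). Let $H_b(p)=-p\log_2p-(1-p)\log_2(1-p)$ and let $H_b^{-1}:[0,1]\to[0,\tfrac12]$ be the inverse of its restriction to $[0,\tfrac12]$. **Theorem.** Let $\alpha\ge 2$ be an integer and $0\le\rho\le 1$. Consider the $(\mathsf M,n)=(2,2)$ IR schemes that satisfy the alphabet restrictions $|\mathcal Q_l|\le\alpha$ and $|\mathcal A|^{\ell_l(q)}\le|\mathcal X|^\beta$ for all $l$ and all $q\in\mathcal Q_l$, that have MI leakage $\rho^{(\mathsf{MI})}\le\rho$, and in which only one of the two servers can leak, i.e. $I(M;\boldsymbol Q_l)=0$ for at least one $l\in\{1,2\}$. Then the maximum of the rate over these schemes is $$\mathsf R^{(\mathsf{MI})}_{\max}=\frac{1}{1+H_b^{-1}\bigl(\max\{0,\,1-2\rho\}\bigr)},$$ that is, $1/[1+H_b^{-1}(1-2\rho)]$ for $\rho\le\frac12$ and $1$ for $\rho\ge\frac12$. This is the maximum for every fixed $\mathcal X$ and $\beta$, and hence also over all $\mathcal X$ and $\beta$. For $\mathcal X=\{0,1\}$ and $\beta=1$ the maximum is attained by the $(2,2)$ Scheme A with parameter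 $p=H_b^{-1}(\max\{0,1-2\rho\})$, which is as follows. Let $S\in\{0,1\}$ with $\Pr[S=1]=p$. If file $m$ is requested, the query to server $l$ is the vector $q_l\in\{0,1\}^2$ that has entry $S$ at the position other than $m$ and satisfies $q_{l,1}+q_{l,2}\equiv l-1 \pmod 2$. Server $l$ returns nothing if $q_l=(0,0)$, and otherwise the single bit $q_{l,1}\boldsymbol X^{(1)}+q_{l,2}\boldsymbol X^{(2)} \bmod 2$. -/

import Mathlib

open MeasureTheory

noncomputable section

namespace WPIR

/-! ### Binary entropy in bits and its inverse -/

/-- The binary entropy function in bits, `-p log₂ p - (1-p) log₂ (1-p)`. -/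
def Hb (p : ℝ) : ℝ := Real.binEntropy p / Real.log 2

/-- The inverse of the restriction of `Hb` to `[0, 1/2]`: for `y ∈ [0, 1]` it is the unique
`p ∈ [0, 1/2]` with `Hb p = y`, see `Hb_bijOn` and `HbInv_spec`. -/
def HbInv (y : ℝ) : ℝ := Function.invFunOn Hb (Set.Icc 0 (1 / 2)) y

theorem Hb_bijOn : Set.BijOn Hb (Set.Icc 0 (1 / 2)) (Set.Icc 0 1) := by
  have hlog : 0 < Real.log 2 := Real.log_pos (by norm_num)
  have h0 : Hb 0 = 0 := by simp [Hb]
  have h1 : Hb (1 / 2) = 1 := by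
    have : Real.binEntropy (1 / 2) = Real.log 2 := by
      rw [one_div]; exact Real.binEntropy_two_inv
    rw [Hb, this, div_self hlog.ne']
  have hmono : StrictMonoOn Hb (Set.Icc 0 (1 / 2)) := by
    intro a ha b hb hab
    rw [one_div] at ha hb
    exact div_lt_div_of_pos_right (Real.binEntropy_strictMonoOn ha hb hab) hlog
  have hcont : Continuous Hb := Real.binEntropy_continuous.div_const _
  refine ⟨fun p hp => ⟨?_, ?_⟩, hmono.injOn, ?_⟩
  · have := hmono.monotoneOn (Set.left_mem_Icc.2 (by norm_num)) hp hp.1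
    rwa [h0] at this
  · have := hmono.monotoneOn hp (Set.right_mem_Icc.2 (by norm_num)) hp.2
    rwa [h1] at this
  · have := intermediate_value_Icc (a := (0 : ℝ)) (b := 1 / 2) (by norm_num) hcont.continuousOn
    rwa [h0, h1] at this

theorem HbInv_spec {y : ℝ} (hy : y ∈ Set.Icc (0 : ℝ) 1) :
    HbInv y ∈ Set.Icc (0 : ℝ) (1 / 2) ∧ Hb (HbInv y) = y := by
  have h : ∃ a ∈ Set.Icc (0 : ℝ) (1 / 2), Hb a = y := Hb_bijOn.surjOn hy
  exact ⟨Function.invFunOn_mem h, Function.invFunOn_eq h⟩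

/-! ### Information retrieval schemes -/

/-- The data of an information retrieval protocol for `n` replicated servers that store `M` files,
each file being a vector of `β` symbols from the alphabet `X`: a random strategy, queries computed
from the requested index and the strategy, and answers of a length that depends on the query
only. Query alphabets are finite; the random strategy lives on an arbitrary probability space. -/
structure Protocol (M n : ℕ) (X : Type*) (β : ℕ) where
  /-- the alphabet of the random strategy -/
  S : Type
  [measurableSpaceS : MeasurableSpace S]
  /-- the distribution of the random strategy -/
  law : Measure S
  [isProbabilityMeasure : IsProbabilityMeasure law]
  /-- the alphabet of the queries to each server -/
  Q : Fin n → Type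
  [fintypeQ : ∀ l, Fintype (Q l)]
  /-- the download symbol alphabet -/
  A : Type
  [fintypeA : Fintype A]
  /-- the query-encoding functions -/
  query : ∀ l, Fin M → S → Q l
  measurableSet_query : ∀ l m q, MeasurableSet {s | query l m s = q}
  /-- the answer-length functions -/
  len : ∀ l, Q l → ℕ
  /-- the answer functions -/
  answer : ∀ l, (q : Q l) → (Fin M → Fin β → X) → (Fin (len l q) → A)
  /-- the access-number functions -/
  access : ∀ l, Q l → ℕ

attribute [instance] Protocol.measurableSpaceS Protocol.isProbabilityMeasure Protocol.fintypeQ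
  Protocol.fintypeA

namespace Protocol

variable {M n : ℕ} {X : Type*} {β : ℕ} (C : Protocol M n X β)

/-- The sample space: an outcome consists of the requested index, the random strategy, and the
contents of the files. -/
abbrev Outcome : Type _ := Fin M × C.S × (Fin M → Fin β → X)

/-- The probability of an event when the requested index is uniform on the `M` indices, the
strategy has distribution `C.law`, all symbols of all files are uniform on `X`, and all of these are
independent. -/
def prob [Fintype X] (E : Set C.Outcome) : ℝ :=
  (M : ℝ)⁻¹ * (Fintype.card (Fin M → Fin β → X) : ℝ)⁻¹ *
    ∑ m : Fin M, ∑ x : Fin M → Fin β → X, C.law.real {s | (m, s, x) ∈ E}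

/-- Mutual information `I(Y; Z)` in bits, of two random variables with finite alphabets. -/
def mutualInfo [Fintype X] {T U : Type*} [Fintype T] [Fintype U]
    (Y : C.Outcome → T) (Z : C.Outcome → U) : ℝ :=
  ∑ t, ∑ u, C.prob {ω | Y ω = t ∧ Z ω = u} *
    Real.logb 2 (C.prob {ω | Y ω = t ∧ Z ω = u} / (C.prob {ω | Y ω = t} * C.prob {ω | Z ω = u}))

/-- Conditional entropy `H(Y | Z)` in bits, of two random variables with finite alphabets. -/
def condEntropy [Fintype X] {T U : Type*} [Fintype T] [Fintype U]
    (Y : C.Outcome → T) (Z : C.Outcome → U) : ℝ :=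
  ∑ t, ∑ u, C.prob {ω | Y ω = t ∧ Z ω = u} *
    Real.logb 2 (C.prob {ω | Z ω = u} / C.prob {ω | Y ω = t ∧ Z ω = u})

theorem condEntropy_eq_zero_of_function [Fintype X] {T U : Type*} [Fintype T] [Fintype U]
    (Y : C.Outcome → T) (Z : C.Outcome → U) (f : U → T) (h : ∀ ω, Y ω = f (Z ω)) :
    C.condEntropy Y Z = 0 := by
  refine Finset.sum_eq_zero fun t _ => Finset.sum_eq_zero fun u _ => ?_
  by_cases htu : f u = t
  · have : {ω | Y ω = t ∧ Z ω = u} = {ω | Z ω = u} := by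
      ext ω
      simp only [Set.mem_ofPred_eq, h, and_iff_right_iff_imp]
      rintro rfl
      exact htu
    rw [this]
    by_cases h0 : C.prob {ω | Z ω = u} = 0
    · simp [h0]
    · simp [div_self h0]
  · have : {ω | Y ω = t ∧ Z ω = u} = ∅ := by
      ext ω
      simp only [Set.mem_ofPred_eq, h, Set.mem_empty_iff_false, iff_false]
      rintro ⟨h1, rfl⟩
      exact htu h1
    rw [this]
    simp [prob]

/-- The requested index. -/
def index (ω : C.Outcome) : Fin M := ω.1

/-- The query sent to server `l`. -/
def queryRV (l : Fin n) (ω : C.Outcome) : C.Q l := C.query l ω.1 ω.2.1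

/-- The requested file. -/
def requestedFile (ω : C.Outcome) : Fin β → X := ω.2.2 ω.1

/-- What the user knows after the download: the requested index, and for every server the query
together with the answer to it. -/
def userView (ω : C.Outcome) : Fin M × (∀ l, Σ q : C.Q l, (Fin (C.len l q) → C.A)) :=
  (ω.1, fun l => ⟨C.queryRV l ω, C.answer l (C.queryRV l ω) ω.2.2⟩)

end Protocol

/-- An `(M, n)` information retrieval scheme: a protocol with perfect retrievability, that is, the
requested file has conditional entropy zero given all answers, all queries, and the index. -/
structure IRScheme (M n : ℕ) (X : Type*) [Fintype X] (β : ℕ) extends Protocol M n X β where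
  retrievability : toProtocol.condEntropy toProtocol.requestedFile toProtocol.userView = 0

namespace IRScheme

variable {M n : ℕ} {X : Type*} [Fintype X] {β : ℕ} (C : IRScheme M n X β)

/-- The leakage `I(M; Q_l)` of the `l`-th server, in bits. -/
def serverLeakage (l : Fin n) : ℝ := C.mutualInfo C.index (C.queryRV l)

/-- The mutual information leakage of the scheme: the average of `I(M; Q_l)` over the servers. -/
def leakageMI : ℝ := (n : ℝ)⁻¹ * ∑ l, C.serverLeakage l

/-- The expected download cost in bits, `log₂ |A| * ∑ l, E[len_l(Q_l)]`. -/
def downloadCost : ℝ :=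
  Real.logb 2 (Fintype.card C.A) *
    ∑ l, ∑ q : C.Q l, C.prob {ω | C.queryRV l ω = q} * (C.len l q : ℝ)

/-- The retrieval rate: the size of a file in bits over the download cost. -/
def rate : ℝ := (β : ℝ) * Real.logb 2 (Fintype.card X) / C.downloadCost

/-- The restrictions on the alphabets: there are at most `α` queries per server, and the alphabet
`A ^ len` of each answer is at most as large as the set `X ^ β` of possible files. -/
def RestrictedAlphabets (α : ℕ) : Prop :=
  (∀ l, Fintype.card (C.Q l) ≤ α) ∧
    ∀ l q, Fintype.card C.A ^ C.len l q ≤ Fintype.card X ^ β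

/-- At most one server learns anything about the requested index. -/
def OnlyOneServerLeaks : Prop :=
  ∀ l l', C.serverLeakage l ≠ 0 → C.serverLeakage l' ≠ 0 → l = l'

/-- The schemes over which the rate is maximized. -/
def Admissible (α : ℕ) (ρ : ℝ) : Prop :=
  C.RestrictedAlphabets α ∧ C.OnlyOneServerLeaks ∧ C.leakageMI ≤ ρ

end IRScheme

/-! ### The `(2, 2)` Scheme A -/

/-- The Bernoulli distribution on `{0, 1}`, with mass `p` at `1`. -/
def bernoulliLaw (p : unitInterval) : Measure (Fin 2) :=
  ENNReal.ofReal (1 - p) • Measure.dirac 0 + ENNReal.ofReal p • Measure.dirac 1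

instance (p : unitInterval) : IsProbabilityMeasure (bernoulliLaw p) := by
  refine ⟨?_⟩
  simp only [bernoulliLaw, Measure.add_apply, Measure.smul_apply, measure_univ, smul_eq_mul,
    mul_one]
  rw [← ENNReal.ofReal_add (by linarith [p.2.2]) p.2.1]
  simp

/-- The `(2, 2)` Scheme A on binary files of one symbol each, with Bernoulli strategy `S`, in terms
of the arithmetic of `Fin 2`, which is modulo 2 (indices and servers are numbered `0, 1`). If the
index `m` is requested, then the query to server `l` is the vector `q` with entry `S` at the other
index and with `q 0 + q 1 = l`. The answer to `q` is the sum of the files `m` with `q m = 1`, and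
nothing is downloaded if `q = 0`. -/
def protocolA (p : unitInterval) : Protocol 2 2 (Fin 2) 1 where
  S := Fin 2
  law := bernoulliLaw p
  Q l := {q : Fin 2 → Fin 2 // q 0 + q 1 = l}
  A := Fin 2
  query l m s := ⟨fun j => if j = m then l - s else s, by revert l m s; decide⟩
  measurableSet_query _ _ _ := MeasurableSet.of_discrete
  len _ q := if q.1 = 0 then 0 else 1
  answer _ q x := fun _ => ∑ m, if q.1 m = 0 then 0 else x m 0
  access _ q := ∑ m, if q.1 m = 0 then 0 else 1

theorem protocolA_retrievability (p : unitInterval) :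
    (protocolA p).condEntropy (protocolA p).requestedFile (protocolA p).userView = 0 := by
  have key : ∀ l (q : (protocolA p).Q l) (x : Fin 2 → Fin 1 → Fin 2),
      @Finset.sum _ (Fin 2) _ Finset.univ (fun i => (protocolA p).answer l q x i) =
        ∑ m, if q.1 m = 0 then (0 : Fin 2) else x m 0 := by
    intro l q x
    change @Finset.sum (Fin ((protocolA p).len l q)) (Fin 2) _ Finset.univ
      (fun _ => ∑ m, if q.1 m = 0 then (0 : Fin 2) else x m 0) = _
    rw [Finset.sum_const, Finset.card_univ, Fintype.card_fin]
    by_cases hq : q.1 = 0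
    · simp [hq]
    · have hl : (protocolA p).len l q = 1 := if_neg hq
      rw [hl, one_smul]
  refine Protocol.condEntropy_eq_zero_of_function _ _ _
    (fun v _ => ∑ l, @Finset.sum _ (Fin 2) _ Finset.univ (fun i => (v.2 l).2 i)) ?_
  rintro ⟨m, s, x⟩
  funext j
  change x m j = ∑ l, @Finset.sum _ (Fin 2) _ Finset.univ
    (fun i => (protocolA p).answer l ((protocolA p).query l m s) x i)
  simp only [key]
  rw [Subsingleton.elim j 0]
  have h : ∀ (m s : Fin 2) (y : Fin 2 → Fin 2), y m = ∑ l : Fin 2, ∑ k : Fin 2,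
      if (if k = m then l - s else s : Fin 2) = 0 then (0 : Fin 2) else y k := by decide
  exact h m s fun k => x k 0

/-- The `(2, 2)` Scheme A with Bernoulli parameter `p`. -/
def schemeA (p : unitInterval) : IRScheme 2 2 (Fin 2) 1 where
  toProtocol := protocolA p
  retrievability := protocolA_retrievability p

end WPIR

end

namespace WPIR

/-! ### Counting answers -/

section Counting

/-! The converse counts answers instead of computing their entropies. Let server `k` be private, `L`
the size of a file in bits, `a` and `b` the log-sizes of the answer alphabets of `k` and of the
other server `l`, and `u m`, `v m` the averages over the value of file `m` of the log-number of
answers of `k` and of `l` that remain possible. For queries that can occur together when `m` is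
requested, decodability gives `L + u m ≤ a + b` and `L + v m ≤ a + b` (`add_fiberLog_le`); if they
occur together for the other index, then `L ≤ u m + v m` (`le_fiberLog_add`).

Average these inequalities. Privacy gives `u m` the same mean under both requests. Since `0 ≤ v m ≤
L`, the mean of `v m` changes between requests by at most `L` times the total variation distance of
the two query laws of server `l`. Hence the cost is at least `L * (1 + e)`, where `e` is half the
sum of `min (P 0 q) (P 1 q)`, the error of the best guess of the index from the query to `l`
(`cost_lower_bound`). Concavity of `Hb` bounds the leakage of `l` below by `1 - Hb e`
(`one_sub_info_le`). That leakage is at most `2 * ρ`, so `e ≥ HbInv (max 0 (1 - 2 * ρ))`.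

Equality holds for Scheme A with `p` equal to this value: server `0` is private and is silent with
probability `1 - p`, and server `1` always sends one file-sized symbol and leaks `1 - Hb p`.
Addition in a cyclic group of order `|X| ^ β` carries the scheme over to every `X` and `β`. -/

open Classical in
/-- The average over `y` of the logarithm of the number of values of `f` on `{x | x i = y}`. -/
noncomputable def fiberLog {ι F T : Type*} [Fintype ι] [Fintype F] (i : ι) (f : (ι → F) → T) : ℝ :=
  ∑ y : F, (Fintype.card F : ℝ)⁻¹ *
    Real.logb 2 ((Finset.univ.filter fun x : ι → F => x i = y).image f).card

variable {ι F T U : Type*} [Fintype ι] [Fintype F]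

open Classical in
theorem card_image_fiber_pos (i : ι) (f : (ι → F) → T) (y : F) :
    0 < ((Finset.univ.filter fun x : ι → F => x i = y).image f).card :=
  Finset.card_pos.2 (Finset.Nonempty.image ⟨fun _ => y, by simp⟩ _)

theorem fiberLog_nonneg (i : ι) (f : (ι → F) → T) : 0 ≤ fiberLog i f := by
  classical
  refine Finset.sum_nonneg fun y _ => mul_nonneg (by positivity) ?_
  exact Real.logb_nonneg one_lt_two (by exact_mod_cast card_image_fiber_pos i f y)

theorem fiberLog_le [Fintype T] [Nonempty F] (i : ι) (f : (ι → F) → T) :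
    fiberLog i f ≤ Real.logb 2 (Fintype.card T) := by
  classical
  have h : ∀ y ∈ (Finset.univ : Finset F), (Fintype.card F : ℝ)⁻¹ *
      Real.logb 2 ((Finset.univ.filter fun x : ι → F => x i = y).image f).card ≤
      (Fintype.card F : ℝ)⁻¹ * Real.logb 2 (Fintype.card T) := fun y _ => by
    refine mul_le_mul_of_nonneg_left (Real.logb_le_logb_of_le one_lt_two ?_ ?_) (by positivity)
    · exact_mod_cast card_image_fiber_pos i f y
    · exact_mod_cast Finset.card_le_univ _
  refine (Finset.sum_le_sum h).trans (le_of_eq ?_)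
  rw [Finset.sum_const, Finset.card_univ, nsmul_eq_mul]
  field_simp

/-- If `f x` and `g x` determine `x i`, then the pair takes at least as many values as there are
pairs of a value `y` of `x i` and a value of `f` on `{x | x i = y}`. -/
theorem add_fiberLog_le [Fintype T] [Fintype U] [Nonempty F] (i : ι) (f : (ι → F) → T) (g : (ι → F) → U)
    (h : ∀ x x', f x = f x' → g x = g x' → x i = x' i) :
    Real.logb 2 (Fintype.card F) + fiberLog i f ≤
      Real.logb 2 (Fintype.card T) + Real.logb 2 (Fintype.card U) := by
  classical
  set r : F → ℕ := fun y => ((Finset.univ.filter fun x : ι → F => x i = y).image f).card with hr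
  have hrpos : ∀ y, 0 < r y := fun y => card_image_fiber_pos i f y
  obtain ⟨y₀⟩ := ‹Nonempty F›
  have : Nonempty T := ⟨f fun _ => y₀⟩
  have : Nonempty U := ⟨g fun _ => y₀⟩
  have hN : (0 : ℝ) < Fintype.card F := by exact_mod_cast Fintype.card_pos_iff.2 ⟨y₀⟩
  -- Different values of `x i` yield disjoint sets of pairs, and the pairs over `y` project onto the
  -- `r y` values of `f`.
  have hsum : ∑ y, r y ≤ Fintype.card T * Fintype.card U := by
    rw [← Fintype.card_prod]
    calc ∑ y, r y ≤ ∑ y : F, ((Finset.univ.filter fun x : ι → F => x i = y).image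
          fun x => (f x, g x)).card := by
          refine Finset.sum_le_sum fun y _ => ?_
          have : (Finset.univ.filter fun x : ι → F => x i = y).image f =
              ((Finset.univ.filter fun x : ι → F => x i = y).image
                fun x => (f x, g x)).image Prod.fst := by
            rw [Finset.image_image]; rfl
          simp only [hr]
          rw [this]
          exact Finset.card_image_le
      _ = (Finset.univ.biUnion fun y : F => (Finset.univ.filter fun x : ι → F => x i = y).image
            fun x => (f x, g x)).card := by
          refine (Finset.card_biUnion ?_).symm
          intro y _ y' _ hyy
          refine Finset.disjoint_left.2 fun p hp hp' => hyy ?_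
          simp only [Finset.mem_image, Finset.mem_filter, Finset.mem_univ, true_and] at hp hp'
          obtain ⟨x, rfl, rfl⟩ := hp
          obtain ⟨x', rfl, hx'⟩ := hp'
          exact h x x' (congrArg Prod.fst hx').symm (congrArg Prod.snd hx').symm
      _ ≤ _ := Finset.card_le_univ _
  -- Jensen: the mean of the logarithms is at most the logarithm of the mean, whose factor `1 / |F|`
  -- cancels against `log |F|`.
  have hjensen : fiberLog i f ≤ Real.logb 2 (∑ y, (Fintype.card F : ℝ)⁻¹ * r y) := by
    have key := strictConcaveOn_log_Ioi.concaveOn.le_map_sum (t := Finset.univ)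
      (w := fun _ : F => (Fintype.card F : ℝ)⁻¹) (p := fun y => (r y : ℝ))
      (fun _ _ => by positivity) (by simp [hN.ne'])
      (fun y _ => by simpa using hrpos y)
    have h2 : 0 < Real.log 2 := Real.log_pos one_lt_two
    have := div_le_div_of_nonneg_right key h2.le
    simp only [smul_eq_mul, Finset.sum_div, mul_div_assoc] at this
    exact this
  have hS : (0 : ℝ) < ∑ y, (Fintype.card F : ℝ)⁻¹ * r y :=
    Finset.sum_pos (fun y _ => mul_pos (inv_pos.2 hN) (by exact_mod_cast hrpos y)) ⟨y₀, by simp⟩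
  have hT : (0 : ℝ) < Fintype.card T := by exact_mod_cast Fintype.card_pos
  have hU : (0 : ℝ) < Fintype.card U := by exact_mod_cast Fintype.card_pos
  refine (add_le_add_right hjensen _).trans ?_
  rw [← Real.logb_mul hN.ne' hS.ne', ← Real.logb_mul hT.ne' hU.ne']
  refine Real.logb_le_logb_of_le one_lt_two (mul_pos hN hS) ?_
  rw [← Finset.mul_sum, mul_inv_cancel_left₀ hN.ne']
  exact_mod_cast hsum

/-- If `f x` and `g x` determine `x i`, then they do so when another coordinate is fixed. -/
theorem le_fiberLog_add [Nonempty F] {i j : ι} (hij : i ≠ j) (f : (ι → F) → T) (g : (ι → F) → U)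
    (h : ∀ x x', f x = f x' → g x = g x' → x i = x' i) :
    Real.logb 2 (Fintype.card F) ≤ fiberLog j f + fiberLog j g := by
  classical
  have hN : (0 : ℝ) < Fintype.card F := by exact_mod_cast Fintype.card_pos
  rw [fiberLog, fiberLog, ← Finset.sum_add_distrib]
  have hL : Real.logb 2 (Fintype.card F) =
      ∑ _y : F, (Fintype.card F : ℝ)⁻¹ * Real.logb 2 (Fintype.card F) := by
    rw [Finset.sum_const, Finset.card_univ, nsmul_eq_mul, mul_inv_cancel_left₀ hN.ne']
  rw [hL]
  refine Finset.sum_le_sum fun y _ => ?_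
  rw [← mul_add]
  refine mul_le_mul_of_nonneg_left ?_ (by positivity)
  have hf := card_image_fiber_pos j f y
  have hg := card_image_fiber_pos j g y
  rw [← Real.logb_mul (by exact_mod_cast hf.ne') (by exact_mod_cast hg.ne')]
  refine Real.logb_le_logb_of_le one_lt_two hN ?_
  rw [← Nat.cast_mul, Nat.cast_le, ← Finset.card_product, ← Finset.card_univ]
  -- Varying coordinate `i` alone keeps coordinate `j` at `y`, and decodability makes the resulting
  -- `|F|` pairs distinct.
  let ext : F → ι → F := fun z => Function.update (fun _ => y) i z
  refine Finset.card_le_card_of_injOn (fun z => (f (ext z), g (ext z))) ?_ ?_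
  · intro z _
    have hz : ext z j = y := Function.update_of_ne hij.symm _ _
    simp only [Finset.coe_product, Set.mem_prod, Finset.mem_coe]
    exact ⟨Finset.mem_image_of_mem _ (by simpa using hz),
      Finset.mem_image_of_mem _ (by simpa using hz)⟩
  · intro z _ z' _ hzz
    have := h (ext z) (ext z') (congrArg Prod.fst hzz) (congrArg Prod.snd hzz)
    simpa [ext] using this

end Counting

/-! ### Binary entropy -/

/-- The contribution of a query to the mutual information, when its conditional probabilities given
the two indices are `f` and `g`. -/
theorem infoTerm_eq {f g : ℝ} (hf : 0 ≤ f) (hg : 0 ≤ g) :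
    2⁻¹ * f * Real.logb 2 (2⁻¹ * f / (2⁻¹ * (2⁻¹ * (f + g)))) +
      2⁻¹ * g * Real.logb 2 (2⁻¹ * g / (2⁻¹ * (2⁻¹ * (f + g)))) =
    2⁻¹ * (f + g) * (1 - Hb (min f g / (f + g))) := by
  have h2 : Real.log 2 ≠ 0 := (Real.log_pos one_lt_two).ne'
  wlog hfg : f ≤ g generalizing f g with H
  · have := H hg hf (le_of_not_ge hfg)
    rw [add_comm g f, min_comm] at this
    rw [← this, add_comm]
  rw [min_eq_left hfg]
  rcases hg.eq_or_lt with rfl | hg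
  · have : f = 0 := le_antisymm hfg hf
    simp [this]
  have hs : 0 < f + g := by linarith
  rw [Hb, Real.binEntropy, one_sub_div hs.ne', add_sub_cancel_left]
  have e2 : Real.logb 2 (2⁻¹ * g / (2⁻¹ * (2⁻¹ * (f + g)))) =
      (Real.log 2 - Real.log (g / (f + g))⁻¹) / Real.log 2 := by
    rw [Real.log_inv, sub_neg_eq_add, ← Real.log_mul two_ne_zero (by positivity), Real.logb]
    congr 2; field_simp
  rw [e2]
  -- At `f = 0` the first term vanishes through its factor; the logarithm identity `e1` needs `f >
  -- 0`.
  rcases hf.eq_or_lt with rfl | hf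
  · field_simp; simp
  have e1 : Real.logb 2 (2⁻¹ * f / (2⁻¹ * (2⁻¹ * (f + g)))) =
      (Real.log 2 - Real.log (f / (f + g))⁻¹) / Real.log 2 := by
    rw [Real.log_inv, sub_neg_eq_add, ← Real.log_mul two_ne_zero (by positivity), Real.logb]
    congr 2; field_simp
  rw [e1]
  field_simp
  ring

theorem Hb_le_one (p : ℝ) : Hb p ≤ 1 :=
  div_le_one_of_le₀ Real.binEntropy_le_log_two (Real.log_pos one_lt_two).le

theorem Hb_eq_one {p : ℝ} : Hb p = 1 ↔ p = 2⁻¹ := by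
  rw [Hb, div_eq_one_iff_eq (Real.log_pos one_lt_two).ne', Real.binEntropy_eq_log_two]

theorem Hb_concaveOn : ConcaveOn ℝ (Set.Icc 0 1) Hb := by
  have := Real.strictConcave_binEntropy.concaveOn.smul (c := (Real.log 2)⁻¹)
    (inv_nonneg.2 (Real.log_pos one_lt_two).le)
  refine this.congr fun x _ => ?_
  simp [Hb, div_eq_inv_mul]

theorem Hb_strictMonoOn : StrictMonoOn Hb (Set.Icc 0 (1 / 2)) := by
  intro a ha b hb hab
  rw [one_div] at ha hb
  exact div_lt_div_of_pos_right (Real.binEntropy_strictMonoOn ha hb hab)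
    (Real.log_pos one_lt_two)

section Information

variable {Q : Type*} [Fintype Q] {f g : Q → ℝ}

/-- If a query has zero mutual information with the index, then its two conditional distributions
agree. -/
theorem eq_of_info_eq_zero (hf : ∀ q, 0 ≤ f q) (hg : ∀ q, 0 ≤ g q)
    (h : ∑ q, 2⁻¹ * (f q + g q) * (1 - Hb (min (f q) (g q) / (f q + g q))) = 0) : f = g := by
  funext q
  have hn : ∀ q ∈ Finset.univ,
      0 ≤ 2⁻¹ * (f q + g q) * (1 - Hb (min (f q) (g q) / (f q + g q))) := fun q _ =>
    mul_nonneg (by linarith [hf q, hg q]) (sub_nonneg.2 (Hb_le_one _))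
  have hq := (Finset.sum_eq_zero_iff_of_nonneg hn).1 h q (Finset.mem_univ q)
  rcases (add_nonneg (hf q) (hg q)).eq_or_lt with h0 | h0
  · linarith [hf q, hg q]
  have h1 : Hb (min (f q) (g q) / (f q + g q)) = 1 := by
    rcases mul_eq_zero.1 hq with h | h <;> linarith
  rw [Hb_eq_one, div_eq_iff h0.ne'] at h1
  rcases min_cases (f q) (g q) with ⟨h, _⟩ | ⟨h, _⟩ <;> rw [h] at h1 <;> linarith

/-- The conditional entropy of the index given a query is at most the binary entropy of the error
probability of the best guess. -/
theorem one_sub_info_le (hf : ∀ q, 0 ≤ f q) (hg : ∀ q, 0 ≤ g q) (hf1 : ∑ q, f q = 1)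
    (hg1 : ∑ q, g q = 1) :
    1 - ∑ q, 2⁻¹ * (f q + g q) * (1 - Hb (min (f q) (g q) / (f q + g q))) ≤
      Hb (2⁻¹ * ∑ q, min (f q) (g q)) := by
  have hw : ∑ q, 2⁻¹ * (f q + g q) = 1 := by
    rw [← Finset.mul_sum, Finset.sum_add_distrib, hf1, hg1]; norm_num
  -- Jensen with the query probabilities as weights and the posterior probabilities of the less
  -- likely index as points.
  have key := Hb_concaveOn.le_map_sum (t := Finset.univ) (w := fun q => 2⁻¹ * (f q + g q))
    (p := fun q => min (f q) (g q) / (f q + g q))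
    (fun q _ => by have := hf q; have := hg q; positivity) hw
    (fun q _ => by
      have h1 := hf q
      have h2 := hg q
      have h3 : 0 ≤ min (f q) (g q) := le_min h1 h2
      exact ⟨by positivity, div_le_one_of_le₀ ((min_le_left _ _).trans (by linarith))
        (by linarith)⟩)
  simp only [smul_eq_mul] at key
  have e1 : ∑ q, 2⁻¹ * (f q + g q) * (min (f q) (g q) / (f q + g q)) =
      2⁻¹ * ∑ q, min (f q) (g q) := by
    rw [Finset.mul_sum]
    refine Finset.sum_congr rfl fun q _ => ?_
    rcases (add_nonneg (hf q) (hg q)).eq_or_lt with h0 | h0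
    · have h1 : f q = 0 := by linarith [hf q, hg q]
      have h2 : g q = 0 := by linarith [hf q, hg q]
      simp [h1, h2]
    · field_simp
  rw [e1] at key
  refine le_trans (le_of_eq ?_) key
  simp only [mul_sub, mul_one, Finset.sum_sub_distrib] at hw ⊢
  rw [hw]; ring

end Information

/-! ### The averaging argument of the converse -/

theorem sum_Fin_two_of_ne {k l : Fin 2} (h : l ≠ k) (f : Fin 2 → ℝ) : ∑ i, f i = f k + f l := by
  rw [Fin.sum_univ_two]
  fin_cases k <;> fin_cases l <;> simp_all [add_comm]

/-- The converse inequality, in terms of the joint conditional distributions `J m` of the queries to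
a private server and to another one. -/
theorem cost_lower_bound {Q Q' : Type*} [Fintype Q] [Fintype Q'] {J : Fin 2 → Q → Q' → ℝ}
    {μ : Q → ℝ} {P : Fin 2 → Q' → ℝ} {a : Q → ℝ} {b : Q' → ℝ} {u : Fin 2 → Q → ℝ}
    {v : Fin 2 → Q' → ℝ} {L : ℝ} (hJ : ∀ m q q', 0 ≤ J m q q')
    (hμ : ∀ m q, ∑ q', J m q q' = μ q) (hP : ∀ m q', ∑ q, J m q q' = P m q')
    (hP1 : ∀ m, ∑ q', P m q' = 1) (hv0 : ∀ m q', 0 ≤ v m q') (hvL : ∀ m q', v m q' ≤ L)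
    (hu : ∀ m q q', 0 < J m q q' → L + u m q ≤ a q + b q')
    (hv : ∀ m q q', 0 < J m q q' → L + v m q' ≤ a q + b q')
    (huv : ∀ m m' q q', m ≠ m' → 0 < J m q q' → L ≤ u m' q + v m' q') :
    L * (1 + 2⁻¹ * ∑ q', min (P 0 q') (P 1 q')) ≤
      ∑ q, μ q * a q + ∑ q', 2⁻¹ * (P 0 q' + P 1 q') * b q' := by
  have hE : ∀ m (x : Q → ℝ) (y : Q' → ℝ), ∑ q, ∑ q', J m q q' * (x q + y q') =
      ∑ q, μ q * x q + ∑ q', P m q' * y q' := by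
    intro m x y
    simp only [mul_add, Finset.sum_add_distrib]
    congr 1
    · exact Finset.sum_congr rfl fun q _ => by rw [← Finset.sum_mul, hμ]
    · rw [Finset.sum_comm]
      exact Finset.sum_congr rfl fun q _ => by rw [← Finset.sum_mul, hP]
  -- `J m` couples the two query laws, so an inequality on its support passes to sums over the
  -- marginals.
  have hmono : ∀ m (x x' : Q → ℝ) (y y' : Q' → ℝ),
      (∀ q q', 0 < J m q q' → x q + y q' ≤ x' q + y' q') →
      ∑ q, μ q * x q + ∑ q', P m q' * y q' ≤ ∑ q, μ q * x' q + ∑ q', P m q' * y' q' := by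
    intro m x x' y y' h
    rw [← hE, ← hE]
    refine Finset.sum_le_sum fun q _ => Finset.sum_le_sum fun q' _ => ?_
    rcases (hJ m q q').eq_or_lt with h0 | h0
    · simp [← h0]
    · exact mul_le_mul_of_nonneg_left (h q q' h0) h0.le
  have hL : ∀ m, ∑ q', P m q' * L = L := fun m => by rw [← Finset.sum_mul, hP1, one_mul]
  have hμ1 : ∑ q, μ q = 1 := by
    simp only [← hμ 0]
    rw [Finset.sum_comm]
    simp only [hP, hP1]
  have hμL : ∑ q, μ q * L = L := by rw [← Finset.sum_mul, hμ1, one_mul]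
  have key : ∀ m m', m ≠ m' → L + L * (2⁻¹ * ∑ q', min (P m q') (P m' q')) ≤
      ∑ q, μ q * a q + ∑ q', P m q' * b q' := by
    intro m m' hmm
    have h1 := hmono m (fun q => u m q) a (fun _ => L) b
      (fun q q' h => by linarith [hu m q q' h])
    have h2 := hmono m (fun q => L) a (v m) b (fun q q' h => hv m q q' h)
    -- Request `m'`, but count answers with file `m` fixed. The private marginal is still `μ`, so
    -- the mean of `u m` here is the one in `h1`.
    have h3 := hmono m' (fun _ => 0) (u m) (fun _ => L) (v m)
      (fun q q' h => by linarith [huv m' m q q' hmm.symm h])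
    -- Change of measure from `P m'` to `P m`: mass beyond the common part `min` costs at most `L`.
    -- Adding `h1` and `h2` and inserting `h3` and `h4` gives twice the claim.
    have h4 : ∑ q', P m' q' * v m q' ≤
        ∑ q', (P m q' * v m q' + (P m' q' * L - L * min (P m q') (P m' q'))) := by
      refine Finset.sum_le_sum fun q' _ => ?_
      have := hv0 m q'
      have := hvL m q'
      rcases min_cases (P m q') (P m' q') with ⟨h, _⟩ | ⟨h, _⟩ <;> rw [h] <;> nlinarith
    rw [Finset.sum_add_distrib, Finset.sum_sub_distrib, hL, ← Finset.mul_sum] at h4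
    simp only [mul_zero, Finset.sum_const_zero, hL, hμL] at h1 h2 h3
    linarith
  have h0 := key 0 1 (by decide)
  have h1 := key 1 0 (by decide)
  simp only [min_comm (P 1 _)] at h1
  have : ∑ q', 2⁻¹ * (P 0 q' + P 1 q') * b q' =
      2⁻¹ * (∑ q', P 0 q' * b q' + ∑ q', P 1 q' * b q') := by
    rw [← Finset.sum_add_distrib, Finset.mul_sum]
    exact Finset.sum_congr rfl fun q _ => by ring
  rw [this]
  linarith


/-! ### Query laws and leakage -/

namespace Protocol

section General

variable {M n : ℕ} {X : Type*} {β : ℕ} (C : Protocol M n X β)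

/-- The conditional probability of a query given the requested index. -/
noncomputable def queryProb (l : Fin n) (m : Fin M) (q : C.Q l) : ℝ :=
  C.law.real {s | C.query l m s = q}

theorem queryProb_nonneg (l : Fin n) (m : Fin M) (q : C.Q l) : 0 ≤ C.queryProb l m q :=
  measureReal_nonneg

/-- The queries to one server partition the strategies. Restricting the law to `E` requires
measurability of the query events only, not of `E`. -/
theorem sum_law_inter_query (l : Fin n) (m : Fin M) (E : Set C.S) :
    ∑ q, C.law.real (E ∩ {s | C.query l m s = q}) = C.law.real E := by
  have h := measureReal_biUnion_finset₀ (μ := C.law.restrict E) (s := Finset.univ)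
    (f := fun q => {s | C.query l m s = q})
    (fun q _ q' _ hqq => (Set.disjoint_left.2 fun s hs hs' =>
      hqq ((show C.query l m s = q from hs).symm.trans hs')).aedisjoint)
    (fun q _ => (C.measurableSet_query l m q).nullMeasurableSet)
  have hU : (⋃ q ∈ Finset.univ, {s | C.query l m s = q}) = Set.univ := by
    ext s; simp
  rw [hU, measureReal_restrict_apply_univ] at h
  rw [h]
  exact Finset.sum_congr rfl fun q _ => by
    rw [measureReal_restrict_apply (C.measurableSet_query l m q), Set.inter_comm]

theorem sum_queryProb (l : Fin n) (m : Fin M) : ∑ q, C.queryProb l m q = 1 := by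
  have := C.sum_law_inter_query l m Set.univ
  simpa [queryProb] using this

variable [Fintype X] [Nonempty X]

/-- For events that ignore the file contents, the sum over contents cancels against the uniform
weight. -/
theorem prob_index_strategy (F : Fin M → Set C.S) :
    C.prob {ω | ω.2.1 ∈ F ω.1} = (M : ℝ)⁻¹ * ∑ m, C.law.real (F m) := by
  have hN : (Fintype.card (Fin M → Fin β → X) : ℝ) ≠ 0 := by
    exact_mod_cast Fintype.card_ne_zero
  simp only [prob, Set.mem_ofPred_eq, Set.ofPred_mem_eq, Finset.sum_const, Finset.card_univ,
    nsmul_eq_mul]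
  rw [← Finset.mul_sum, mul_assoc, inv_mul_cancel_left₀ hN]

theorem prob_query (l : Fin n) (q : C.Q l) :
    C.prob {ω | C.queryRV l ω = q} = (M : ℝ)⁻¹ * ∑ m, C.queryProb l m q :=
  C.prob_index_strategy fun m => {s | C.query l m s = q}

theorem prob_index_query (l : Fin n) (m : Fin M) (q : C.Q l) :
    C.prob {ω | C.index ω = m ∧ C.queryRV l ω = q} = (M : ℝ)⁻¹ * C.queryProb l m q := by
  have := C.prob_index_strategy fun m' => {s | m' = m ∧ C.query l m' s = q}
  refine this.trans ?_
  rw [Finset.sum_eq_single m]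
  · simp [queryProb]
  · intro m' _ h
    simp [h]
  · simp

theorem prob_index (m : Fin M) : C.prob {ω | C.index ω = m} = (M : ℝ)⁻¹ := by
  have := C.prob_index_strategy fun m' => {_s | m' = m}
  refine this.trans ?_
  rw [Finset.sum_eq_single m]
  · simp
  · intro m' _ h
    simp [h]
  · simp

end General

/-- The mutual information of the index and a query, for two files. -/
theorem mutualInfo_index_query {n : ℕ} {X : Type*} {β : ℕ} [Fintype X] [Nonempty X]
    (C : Protocol 2 n X β) (l : Fin n) :
    C.mutualInfo C.index (C.queryRV l) =
      ∑ q, 2⁻¹ * (C.queryProb l 0 q + C.queryProb l 1 q) *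
        (1 - Hb (min (C.queryProb l 0 q) (C.queryProb l 1 q) /
          (C.queryProb l 0 q + C.queryProb l 1 q))) := by
  rw [mutualInfo, Fin.sum_univ_two, ← Finset.sum_add_distrib]
  refine Finset.sum_congr rfl fun q _ => ?_
  rw [← infoTerm_eq (C.queryProb_nonneg l 0 q) (C.queryProb_nonneg l 1 q)]
  simp only [prob_index_query, prob_index, prob_query, Fin.sum_univ_two, Nat.cast_ofNat]

end Protocol

/-! ### Decodability of queries that occur with positive probability -/

namespace IRScheme

section Decoding

variable {M n : ℕ} {X : Type*} [Fintype X] {β : ℕ} (C : IRScheme M n X β)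

/-- Queries of positive probability have answers that determine the requested file. -/
theorem file_eq_of_answer_eq (m : Fin M) (q : ∀ l, C.Q l)
    (hq : 0 < C.law.real {s | ∀ l, C.query l m s = q l}) (x x' : Fin M → Fin β → X)
    (h : ∀ l, C.answer l (q l) x = C.answer l (q l) x') : x m = x' m := by
  classical
  by_contra hne
  have hmono : ∀ {E F : Set C.Outcome}, E ⊆ F → C.prob E ≤ C.prob F := by
    intro E F hEF
    refine mul_le_mul_of_nonneg_left (Finset.sum_le_sum fun m _ => Finset.sum_le_sum fun x _ => ?_)
      (by positivity)
    exact measureReal_mono fun s hs => hEF hs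
  have hnn : ∀ E : Set C.Outcome, 0 ≤ C.prob E := fun E =>
    mul_nonneg (by positivity) (Finset.sum_nonneg fun m _ => Finset.sum_nonneg fun x _ =>
      measureReal_nonneg)
  -- Both `x` and `x'` produce this view. If their files `m` differed, the view would leave the file
  -- uncertain and contribute a positive term to the conditional entropy.
  let u : Fin M × (∀ l, Σ q : C.Q l, (Fin (C.len l q) → C.A)) :=
    (m, fun l => ⟨q l, C.answer l (q l) x⟩)
  have hu : ∀ z, (∀ l, C.answer l (q l) z = C.answer l (q l) x) →
      {s | ∀ l, C.query l m s = q l} ⊆ {s | C.userView (m, s, z) = u} := by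
    intro z hz s hs
    refine Prod.ext rfl (funext fun l => ?_)
    change (⟨C.query l m s, C.answer l (C.query l m s) z⟩ :
      Σ q : C.Q l, (Fin (C.len l q) → C.A)) = ⟨q l, C.answer l (q l) x⟩
    rw [show C.query l m s = q l from hs l, hz l]
  have hpos : ∀ z, (∀ l, C.answer l (q l) z = C.answer l (q l) x) →
      0 < C.prob {ω | C.requestedFile ω = z m ∧ C.userView ω = u} := by
    intro z hz
    have : Nonempty (Fin M → Fin β → X) := ⟨z⟩
    have hM : 0 < M := m.pos
    have hN : 0 < Fintype.card (Fin M → Fin β → X) := Fintype.card_pos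
    refine mul_pos (by positivity) ?_
    refine Finset.sum_pos' (fun _ _ => Finset.sum_nonneg fun _ _ => measureReal_nonneg)
      ⟨m, Finset.mem_univ _, Finset.sum_pos' (fun _ _ => measureReal_nonneg)
        ⟨z, Finset.mem_univ _, ?_⟩⟩
    refine hq.trans_le (measureReal_mono fun s hs => ?_)
    exact ⟨rfl, hu z hz hs⟩
  have hadd : C.prob {ω | C.requestedFile ω = x m ∧ C.userView ω = u} +
      C.prob {ω | C.requestedFile ω = x' m ∧ C.userView ω = u} ≤
      C.prob {ω | C.userView ω = u} := by
    rw [Protocol.prob, Protocol.prob, Protocol.prob, ← mul_add, ← Finset.sum_add_distrib]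
    refine mul_le_mul_of_nonneg_left (Finset.sum_le_sum fun i _ => ?_) (by positivity)
    rw [← Finset.sum_add_distrib]
    refine Finset.sum_le_sum fun z _ => ?_
    change C.law.real {s | z i = x m ∧ C.userView (i, s, z) = u} +
      C.law.real {s | z i = x' m ∧ C.userView (i, s, z) = u} ≤
      C.law.real {s | C.userView (i, s, z) = u}
    by_cases h1 : z i = x m
    · simp [h1, hne]
    · by_cases h2 : z i = x' m
      · simp [h2, Ne.symm hne]
      · simp [h1, h2]
  have hx := hpos x fun _ => rfl
  have hx' := hpos x' fun l => (h l).symm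
  have hterm : ∀ t v, 0 ≤ C.prob {ω | C.requestedFile ω = t ∧ C.userView ω = v} *
      Real.logb 2 (C.prob {ω | C.userView ω = v} /
        C.prob {ω | C.requestedFile ω = t ∧ C.userView ω = v}) := by
    intro t v
    rcases (hnn {ω | C.requestedFile ω = t ∧ C.userView ω = v}).eq_or_lt with h0 | h0
    · simp [← h0]
    · exact mul_nonneg h0.le (Real.logb_nonneg one_lt_two
        ((one_le_div h0).2 (hmono fun ω hω => hω.2)))
  have hzero := C.retrievability
  rw [Protocol.condEntropy, Finset.sum_eq_zero_iff_of_nonneg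
    fun t _ => Finset.sum_nonneg fun v _ => hterm t v] at hzero
  have hzero := (Finset.sum_eq_zero_iff_of_nonneg fun v _ => hterm (x m) v).1
    (hzero (x m) (Finset.mem_univ _)) u (Finset.mem_univ _)
  have hlog : 0 < Real.logb 2 (C.prob {ω | C.userView ω = u} /
      C.prob {ω | C.requestedFile ω = x m ∧ C.userView ω = u}) :=
    Real.logb_pos one_lt_two ((one_lt_div hx).2 (by linarith))
  exact (mul_pos hx hlog).ne' hzero

end Decoding

/-! ### Converse -/

section Converse

variable {X : Type*} [Fintype X] {β : ℕ} (C : IRScheme 2 2 X β)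

/-- Passes from a family of queries to a pair. Query types depend on the server, so the family is
taken from one strategy `s₀` that realizes the pair. -/
theorem file_eq_of_answers_eq {k l : Fin 2} (hkl : l ≠ k) {m : Fin 2} {q : C.Q k} {q' : C.Q l}
    (hq : 0 < C.law.real {s | C.query k m s = q ∧ C.query l m s = q'})
    (x x' : Fin 2 → Fin β → X) (hk : C.answer k q x = C.answer k q x')
    (hl : C.answer l q' x = C.answer l q' x') : x m = x' m := by
  obtain ⟨s₀, rfl, rfl⟩ : {s | C.query k m s = q ∧ C.query l m s = q'}.Nonempty := by
    by_contra h
    rw [Set.not_nonempty_iff_eq_empty] at h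
    simp [h] at hq
  have hi : ∀ i : Fin 2, i = k ∨ i = l := by omega
  refine C.file_eq_of_answer_eq m (fun i => C.query i m s₀) ?_ x x' ?_
  · refine hq.trans_le (measureReal_mono fun s hs i => ?_)
    rcases hi i with rfl | rfl
    exacts [hs.1, hs.2]
  · intro i
    rcases hi i with rfl | rfl
    exacts [hk, hl]

theorem downloadCost_eq [Nonempty X] : C.downloadCost = ∑ l, ∑ q : C.Q l,
    2⁻¹ * (C.queryProb l 0 q + C.queryProb l 1 q) *
      Real.logb 2 (Fintype.card (Fin (C.len l q) → C.A)) := by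
  rw [downloadCost, Finset.mul_sum]
  refine Finset.sum_congr rfl fun l _ => ?_
  rw [Finset.mul_sum]
  refine Finset.sum_congr rfl fun q _ => ?_
  rw [Protocol.prob_query, Fin.sum_univ_two, Fintype.card_fun, Fintype.card_fin, Nat.cast_pow,
    Real.logb_pow, Nat.cast_ofNat]
  ring

/-- The converse for a scheme in which server `k` is private, in terms of the error probability of
the best guess of the index by the other server. -/
theorem le_downloadCost_of_private [Nonempty X] {α : ℕ} (hC : C.RestrictedAlphabets α) {k l : Fin 2}
    (hkl : l ≠ k) (hk : C.serverLeakage k = 0) :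
    β * Real.logb 2 (Fintype.card X) *
      (1 + 2⁻¹ * ∑ q, min (C.queryProb l 0 q) (C.queryProb l 1 q)) ≤ C.downloadCost := by
  rw [serverLeakage, Protocol.mutualInfo_index_query] at hk
  have hpriv := eq_of_info_eq_zero (C.queryProb_nonneg k 0) (C.queryProb_nonneg k 1) hk
  have hL : Real.logb 2 (Fintype.card (Fin β → X)) = β * Real.logb 2 (Fintype.card X) := by
    rw [Fintype.card_fun, Fintype.card_fin, Nat.cast_pow, Real.logb_pow]
  rw [← hL]
  -- The bound on answer alphabets enters here: it yields `v ≤ L`, which the change of measure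
  -- needs.
  have hle : ∀ i (q : C.Q i), Real.logb 2 (Fintype.card (Fin (C.len i q) → C.A)) ≤
      Real.logb 2 (Fintype.card (Fin β → X)) := fun i q => by
    have : Nonempty (Fin (C.len i q) → C.A) := by
      obtain ⟨x⟩ := ‹Nonempty X›
      exact ⟨C.answer i q fun _ _ => x⟩
    refine Real.logb_le_logb_of_le one_lt_two (by exact_mod_cast Fintype.card_pos) ?_
    rw [Nat.cast_le]
    simpa using hC.2 i q
  have hne : ∀ m m' : Fin 2, m ≠ m' → m' ≠ m := fun _ _ h => h.symm
  have key := cost_lower_bound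
    (J := fun m q q' => C.law.real {s | C.query k m s = q ∧ C.query l m s = q'})
    (μ := C.queryProb k 0) (P := C.queryProb l)
    (a := fun q => Real.logb 2 (Fintype.card (Fin (C.len k q) → C.A)))
    (b := fun q => Real.logb 2 (Fintype.card (Fin (C.len l q) → C.A)))
    (u := fun m q => fiberLog m (C.answer k q)) (v := fun m q => fiberLog m (C.answer l q))
    (L := Real.logb 2 (Fintype.card (Fin β → X)))
    (fun _ _ _ => measureReal_nonneg)
    (fun m q => by
      have h := C.sum_law_inter_query l m {s | C.query k m s = q}
      refine h.trans ?_
      have : m = 0 ∨ m = 1 := by omega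
      rcases this with rfl | rfl
      · rfl
      · exact (congrFun hpriv q).symm)
    (fun m q' => by
      have h := C.sum_law_inter_query k m {s | C.query l m s = q'}
      simp only [Set.inter_comm] at h
      exact h)
    (C.sum_queryProb l) (fun m q' => fiberLog_nonneg _ _)
    (fun m q' => (fiberLog_le _ _).trans (hle l q'))
    (fun m q q' h => add_fiberLog_le m _ _ (C.file_eq_of_answers_eq hkl h))
    (fun m q q' h => by
      rw [add_comm (Real.logb 2 (Fintype.card (Fin (C.len k q) → C.A)))]
      exact add_fiberLog_le m _ _ fun x x' h1 h2 => C.file_eq_of_answers_eq hkl h x x' h2 h1)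
    (fun m m' q q' hmm h => le_fiberLog_add hmm _ _ (C.file_eq_of_answers_eq hkl h))
  refine key.trans (le_of_eq ?_)
  rw [downloadCost_eq, sum_Fin_two_of_ne hkl]
  congr 1
  refine Finset.sum_congr rfl fun q _ => ?_
  rw [← congrFun hpriv q]
  ring

theorem exists_private (hC : C.OnlyOneServerLeaks) : ∃ k, C.serverLeakage k = 0 := by
  by_contra! h
  exact absurd (hC 0 1 (h 0) (h 1)) (by decide)

/-- With one server private, the averaged leakage leaves the other a budget of `2 * ρ`; monotonicity
of `Hb` on `[0, 1/2]` turns this into a lower bound on the guessing error `e`. -/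
theorem Admissible.le_downloadCost [Nonempty X] {C : IRScheme 2 2 X β} {α : ℕ} {ρ : ℝ} (hρ : 0 ≤ ρ)
    (hC : C.Admissible α ρ) :
    β * Real.logb 2 (Fintype.card X) * (1 + HbInv (max 0 (1 - 2 * ρ))) ≤ C.downloadCost := by
  obtain ⟨k, hk⟩ := C.exists_private hC.2.1
  obtain ⟨l, hkl⟩ := exists_ne k
  refine le_trans (mul_le_mul_of_nonneg_left ?_ ?_) (C.le_downloadCost_of_private hC.1 hkl hk)
  swap
  · exact mul_nonneg (Nat.cast_nonneg _)
      (Real.logb_nonneg one_lt_two (by exact_mod_cast Fintype.card_pos))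
  have hleak : C.serverLeakage l ≤ 2 * ρ := by
    have := hC.2.2
    rw [leakageMI, sum_Fin_two_of_ne hkl, hk, Nat.cast_ofNat] at this
    linarith
  rw [serverLeakage, Protocol.mutualInfo_index_query] at hleak
  have hinfo := one_sub_info_le (C.queryProb_nonneg l 0) (C.queryProb_nonneg l 1)
    (C.sum_queryProb l 0) (C.sum_queryProb l 1)
  set e := 2⁻¹ * ∑ q, min (C.queryProb l 0 q) (C.queryProb l 1 q) with he
  have he0 : 0 ≤ e := mul_nonneg (by norm_num) (Finset.sum_nonneg fun q _ =>
    le_min (C.queryProb_nonneg l 0 q) (C.queryProb_nonneg l 1 q))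
  have he1 : e ≤ 1 / 2 := by
    have : ∑ q, min (C.queryProb l 0 q) (C.queryProb l 1 q) ≤ 1 :=
      (Finset.sum_le_sum fun q _ => min_le_left _ _).trans (C.sum_queryProb l 0).le
    linarith
  obtain ⟨hp, hpH⟩ := HbInv_spec (y := max 0 (1 - 2 * ρ))
    ⟨le_max_left _ _, max_le zero_le_one (by linarith)⟩
  have : Hb (HbInv (max 0 (1 - 2 * ρ))) ≤ Hb e := by
    rw [hpH]
    exact max_le (Hb_bijOn.mapsTo ⟨he0, he1⟩).1 (by linarith)
  have := (Hb_strictMonoOn.le_iff_le hp ⟨he0, he1⟩).1 this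
  linarith

end Converse

/-! ### Achievability -/

section Achievability

/-- A scheme with the query distributions and answer lengths of Scheme A has maximal rate. -/
theorem admissible_and_rate_eq {X : Type*} [Fintype X] [Nontrivial X] {β : ℕ} (hβ : 1 ≤ β)
    (C : IRScheme 2 2 X β) {α : ℕ} (hα : 2 ≤ α) {ρ : ℝ} (hρ₀ : 0 ≤ ρ) (p : unitInterval)
    (hp : (p : ℝ) = HbInv (max 0 (1 - 2 * ρ))) (e : ∀ l, C.Q l ≃ Fin 2)
    (hA : Fintype.card C.A = Fintype.card X ^ β)
    (hlen : ∀ l q, C.len l q = if l = 0 ∧ e l q = 0 then 0 else 1)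
    (hQ : ∀ l m q, C.queryProb l m q =
      if (if m = 0 then l - e l q else e l q) = 0 then 1 - (p : ℝ) else p) :
    C.Admissible α ρ ∧ C.rate = 1 / (1 + HbInv (max 0 (1 - 2 * ρ))) := by
  obtain ⟨hpI, hpH⟩ := HbInv_spec (y := max 0 (1 - 2 * ρ))
    ⟨le_max_left _ _, max_le zero_le_one (by linarith)⟩
  rw [← hp] at hpI hpH ⊢
  have hmin : min (p : ℝ) (1 - p) = p := min_eq_left (by linarith [hpI.2])
  have hmin' : min (1 - p : ℝ) p = p := min_eq_right (by linarith [hpI.2])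
  have hhalf : Hb (1 / 2) = 1 := Hb_eq_one.2 (by norm_num)
  have hself : ∀ x : ℝ, 2⁻¹ * (x + x) * (1 - Hb (x / (x + x))) = 0 := by
    intro x
    rcases eq_or_ne x 0 with rfl | hx
    · simp
    · rw [show x / (x + x) = 1 / 2 by field_simp; norm_num, hhalf]
      simp
  -- Modulo 2, `0 - a = a`, so the query to server `0` has the same law for both requests. For
  -- server `1`, `1 - a` swaps the probabilities `p` and `1 - p`.
  have hl0 : C.serverLeakage 0 = 0 := by
    rw [serverLeakage, Protocol.mutualInfo_index_query, ← (e 0).symm.sum_comp,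
      Fin.sum_univ_two]
    simp [hQ, hself]
  have hl1 : C.serverLeakage 1 = 1 - Hb p := by
    rw [serverLeakage, Protocol.mutualInfo_index_query, ← (e 1).symm.sum_comp,
      Fin.sum_univ_two]
    simp [hQ, hmin, hmin']
    ring
  have hcost : C.downloadCost = β * Real.logb 2 (Fintype.card X) * (1 + p) := by
    rw [downloadCost, hA, Nat.cast_pow, Real.logb_pow, Fin.sum_univ_two,
      ← (e 0).symm.sum_comp, ← (e 1).symm.sum_comp]
    congr 1
    simp only [Protocol.prob_query, Fin.sum_univ_two, hQ, hlen]
    simp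
    ring
  have hLpos : 0 < β * Real.logb 2 (Fintype.card X) :=
    mul_pos (by exact_mod_cast hβ)
      (Real.logb_pos one_lt_two (by exact_mod_cast Fintype.one_lt_card))
  refine ⟨⟨⟨fun l => ?_, fun l q => ?_⟩, ?_, ?_⟩, ?_⟩
  · rw [Fintype.card_congr (e l), Fintype.card_fin]; exact hα
  · rw [hlen, hA]
    split_ifs
    · rw [pow_zero]; exact Nat.one_le_pow _ _ Fintype.card_pos
    · rw [pow_one]
  · intro l l' h h'
    have : ∀ i : Fin 2, C.serverLeakage i ≠ 0 → i = 1 := fun i hi => by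
      by_contra h1
      obtain rfl : i = 0 := by omega
      exact hi hl0
    rw [this l h, this l' h']
  · rw [leakageMI, Fin.sum_univ_two, hl0, hl1, hpH, Nat.cast_ofNat]
    linarith [le_max_right 0 (1 - 2 * ρ)]
  · rw [rate, hcost, div_mul_cancel_left₀ hLpos.ne', one_div]

end Achievability

end IRScheme

theorem bernoulliLaw_real_singleton (p : unitInterval) (i : Fin 2) :
    (bernoulliLaw p).real {i} = if i = 0 then 1 - (p : ℝ) else p := by
  have h0 := p.2.1
  have h1 := p.2.2
  fin_cases i <;> simp [bernoulliLaw, Measure.real, h0, h1]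

/-- Both `s ↦ l - s` and the identity are involutions, so the event is a single strategy. -/
theorem bernoulliLaw_real_eq (p : unitInterval) (l m q : Fin 2) :
    (bernoulliLaw p).real {s | (if m = 0 then l - s else s) = q} =
      if (if m = 0 then l - q else q) = 0 then 1 - (p : ℝ) else p := by
  rw [← bernoulliLaw_real_singleton]
  congr 1
  ext s
  revert l m q s
  decide

/-! ### Scheme A on files in a finite group -/

/-- Scheme A for files that are encoded as elements of a group `G`. A query is represented by its
entry at the index `0`: server `0` returns nothing or the sum of the two files, and server `1`
returns one of the two files. -/
noncomputable def groupProtocolA {X : Type*} {β : ℕ} {G : Type} [AddCommGroup G] [Fintype G]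
    (g : (Fin β → X) ≃ G) (p : unitInterval) : Protocol 2 2 X β where
  S := Fin 2
  law := bernoulliLaw p
  Q _ := Fin 2
  A := G
  query l m s := if m = 0 then l - s else s
  measurableSet_query _ _ _ := MeasurableSet.of_discrete
  len l q := if l = 0 ∧ q = 0 then 0 else 1
  answer l q x := fun _ =>
    if l = 0 then g (x 0) + g (x 1) else if q = 1 then g (x 0) else g (x 1)
  access l q := if l = 0 then (if q = 0 then 0 else 2) else 1

/-- Scheme A for files that are encoded as elements of a group. -/
noncomputable def groupSchemeA {X : Type*} [Fintype X] {β : ℕ} {G : Type} [AddCommGroup G]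
    [Fintype G] (g : (Fin β → X) ≃ G) (p : unitInterval) : IRScheme 2 2 X β where
  toProtocol := groupProtocolA g p
  retrievability := by
    refine Protocol.condEntropy_eq_zero_of_function _ _ _
      -- If server `0` is silent, server `1` has sent the requested file; otherwise it has sent the
      -- other file, which is subtracted from the sum. Summing over the answer's positions reads off
      -- its symbol without a dependent index.
      (fun v => g.symm (if (show Fin 2 from (v.2 0).1) = 0
        then @Finset.sum _ G _ Finset.univ (fun i => (v.2 1).2 i)
        else @Finset.sum _ G _ Finset.univ (fun i => (v.2 0).2 i) -
          @Finset.sum _ G _ Finset.univ (fun i => (v.2 1).2 i))) ?_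
    rintro ⟨m, s, x⟩
    rw [Equiv.eq_symm_apply]
    have key : ∀ m s : Fin 2, g (x m) = if (if m = 0 then 0 - s else s) = 0
        then ∑ _i : Fin (if (1 : Fin 2) = 0 ∧ (if m = 0 then 1 - s else s) = 0 then 0 else 1),
          (if (1 : Fin 2) = 0 then g (x 0) + g (x 1)
            else if (if m = 0 then 1 - s else s) = 1 then g (x 0) else g (x 1))
        else (∑ _i : Fin (if (0 : Fin 2) = 0 ∧ (if m = 0 then 0 - s else s) = 0 then 0 else 1),
            (if (0 : Fin 2) = 0 then g (x 0) + g (x 1)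
              else if (if m = 0 then 0 - s else s) = 1 then g (x 0) else g (x 1))) -
          ∑ _i : Fin (if (1 : Fin 2) = 0 ∧ (if m = 0 then 1 - s else s) = 0 then 0 else 1),
            (if (1 : Fin 2) = 0 then g (x 0) + g (x 1)
              else if (if m = 0 then 1 - s else s) = 1 then g (x 0) else g (x 1)) := by
      intro m s
      fin_cases m <;> fin_cases s <;> simp
    exact key m s

theorem groupSchemeA_spec {X : Type*} [Fintype X] [Nontrivial X] {β : ℕ} (hβ : 1 ≤ β) {G : Type}
    [AddCommGroup G] [Fintype G] (g : (Fin β → X) ≃ G) {α : ℕ} (hα : 2 ≤ α) {ρ : ℝ} (hρ₀ : 0 ≤ ρ)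
    (p : unitInterval) (hp : (p : ℝ) = HbInv (max 0 (1 - 2 * ρ))) :
    (groupSchemeA g p).Admissible α ρ ∧
      (groupSchemeA g p).rate = 1 / (1 + HbInv (max 0 (1 - 2 * ρ))) := by
  refine (groupSchemeA g p).admissible_and_rate_eq hβ hα hρ₀ p hp (fun _ => Equiv.refl _) ?_
    (fun _ _ => rfl) fun l m q => bernoulliLaw_real_eq p l m q
  change Fintype.card G = _
  rw [← Fintype.card_congr g, Fintype.card_fun, Fintype.card_fin]

/-- A query of Scheme A is determined by its entry at the index `0`. -/
def queryEquiv (l : Fin 2) : {q : Fin 2 → Fin 2 // q 0 + q 1 = l} ≃ Fin 2 where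
  toFun q := q.1 0
  invFun a := ⟨![a, l - a], by simp⟩
  left_inv q := by
    refine Subtype.ext (funext fun i => ?_)
    have h := q.2
    fin_cases i
    · rfl
    · simp [← h]
  right_inv _ := rfl

theorem schemeA_spec {α : ℕ} (hα : 2 ≤ α) {ρ : ℝ} (hρ₀ : 0 ≤ ρ)
    (p : unitInterval) (hp : (p : ℝ) = HbInv (max 0 (1 - 2 * ρ))) :
    (schemeA p).Admissible α ρ ∧
      (schemeA p).rate = 1 / (1 + HbInv (max 0 (1 - 2 * ρ))) := by
  refine (schemeA p).admissible_and_rate_eq le_rfl hα hρ₀ p hp queryEquiv (by simp [schemeA,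
    protocolA]) ?_ ?_
  · intro l q
    have : ∀ (l : Fin 2) (q : {q : Fin 2 → Fin 2 // q 0 + q 1 = l}),
        q.1 = 0 ↔ l = 0 ∧ q.1 0 = 0 := by decide
    exact if_congr (this l q) rfl rfl
  · intro l m q
    rw [← bernoulliLaw_real_eq]
    change (bernoulliLaw p).real _ = _
    congr 1
    ext s
    have : ∀ (l m s : Fin 2) (q : {q : Fin 2 → Fin 2 // q 0 + q 1 = l}),
        (fun j : Fin 2 => if j = m then l - s else s) = q.1 ↔
          (if m = 0 then l - s else s) = q.1 0 := by decide
    exact Subtype.ext_iff.trans (this l m s q)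

end WPIR

theorem mainTheorem4 (α : ℕ) (hα : 2 ≤ α) (ρ : ℝ) (hρ₀ : 0 ≤ ρ) (hρ₁ : ρ ≤ 1) :
    (∀ (X : Type) [Fintype X] [Nontrivial X] (β : ℕ), 1 ≤ β →
      IsGreatest {R : ℝ | ∃ C : WPIR.IRScheme 2 2 X β, C.Admissible α ρ ∧ C.rate = R}
        (1 / (1 + WPIR.HbInv (max 0 (1 - 2 * ρ))))) ∧
    ∃ p : unitInterval, (p : ℝ) = WPIR.HbInv (max 0 (1 - 2 * ρ)) ∧
      (WPIR.schemeA p).Admissible α ρ ∧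
      (WPIR.schemeA p).rate = 1 / (1 + WPIR.HbInv (max 0 (1 - 2 * ρ))) := by
  obtain ⟨hpI, -⟩ := WPIR.HbInv_spec (y := max 0 (1 - 2 * ρ))
    ⟨le_max_left _ _, max_le zero_le_one (by linarith)⟩
  obtain ⟨p, hp⟩ : ∃ p : unitInterval, (p : ℝ) = WPIR.HbInv (max 0 (1 - 2 * ρ)) :=
    ⟨⟨_, hpI.1, hpI.2.trans (by norm_num)⟩, rfl⟩
  refine ⟨fun X _ _ β hβ => ⟨?_, ?_⟩, p, hp, WPIR.schemeA_spec hα hρ₀ p hp⟩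
  · have : NeZero (Fintype.card (Fin β → X)) := ⟨Fintype.card_ne_zero⟩
    -- Any bijection serves: the scheme uses only the group law on the encoded files.
    have g : (Fin β → X) ≃ ZMod (Fintype.card (Fin β → X)) :=
      Fintype.equivOfCardEq (ZMod.card _).symm
    exact ⟨_, WPIR.groupSchemeA_spec hβ g hα hρ₀ p hp⟩
  · rintro _ ⟨C, hC, rfl⟩
    have hLpos : 0 < β * Real.logb 2 (Fintype.card X) :=
      mul_pos (by exact_mod_cast hβ)
        (Real.logb_pos one_lt_two (by exact_mod_cast Fintype.one_lt_card))
    have h1 : 0 < 1 + WPIR.HbInv (max 0 (1 - 2 * ρ)) := by linarith [hpI.1]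
    have hcost := hC.le_downloadCost hρ₀
    rw [WPIR.IRScheme.rate, div_le_div_iff₀ ((mul_pos hLpos h1).trans_le hcost) h1, one_mul]
    exact hcost
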